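/- For distributions $q_1,q_2$ on $[n]=\{1,\dots,n\}$ and $\alpha\in[0,1]$ let $q_\alpha=(1-\alpha)q_1+\alpha q_2$, and let $\Pi_{q_1,q_2}=\{q_\alpha : \alpha\in[0,1]\}$ be the set of mixtures of $q_1$ and $q_2$. For $\epsilon>0$, an *identity tester in the presence of known noise* for $(q_1,q_2,\epsilon)$ is a (possibly randomized) algorithm that knows $n,\epsilon,q_1,q_2$, draws independent samples from an unknown distribution $p$ on $[n]$, and, for every $p$, accepts with probability at least $2/3$ if $p\in\Pi_{q_1,q_2}$, and rejects with probability at least $2/3$ if $\|p-q\|_1\ge\epsilon$ for all $q\in\Pi_{q_1,q_2}$. Consider the following algorithm, with $m$ and $s$ samples in its two phases. 1. *Learn.* Let $\epsilon'=\epsilon/6$. If $\|q_1-q_2\|_1<\epsilon'$, set $\alpha=0$. Otherwise let $S=\{i : q_1(i)>q_2(i)\}$, let $w_S$ be the fraction of $m$ samples from $p$ that lie in $S$, and let $\alpha$ be the number $\frac{q_1(S)-(w_S+\epsilon'/4)}{q_1(S)-q_2(S)}$, truncated to $[0,1]$. 2. *Reshape.* Let $a_i=\lfloor n q_\alpha(i)\rfloor+\left\lfloor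 \frac{n|q_\alpha(i)-q_2(i)|}{\|q_\alpha-q_2\|_1}\right\rfloor+1$ (the middle term being $0$ if $q_\alpha=q_2$), $D=\{(i,j): i\in[n],\ j\in[a_i]\}$ and $q'_\alpha(i,j)=q_\alpha(i)/a_i$. Draw $s$ further samples from $p$, and replace each such sample $i$ by $(i,r)$ with $r$ uniform in $[a_i]$, independently. 3. *Test.* With $Y_d$ the number of occurrences of $d\in D$ among these $s$ pairs, accept if and only if $$\sum_{d\in D}\left(\frac{Y_d(Y_d-1)}{s(s-1)}-\frac{2\,q'_\alpha(d)\,Y_d}{s}+q'_\alpha(d)^2\right)\le\frac{\epsilon^2}{2|D|}$$ (the left side estimates the squared $\ell_2$-distance of the sampled distribution to $q'_\alpha$; fractions with denominator $0$ are read as $0$, here and in step 1). **Upper bound.** There are absolute constants $C_1,C_2,C>0$ such that for all $n$, all $\epsilon>0$ and all distributions $q_1,q_2$ on $[n]$, this algorithm with $m=\lfloor C_1/\epsilon^2\rfloor$ and $s=\lfloor C_2\sqrt n/\epsilon^2\rfloor$ is an identity tester in the presence of known noise for $(q_1,q_2,\epsilon)$, and it uses $m+s\le C\sqrt n/\epsilon^2$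 samples. **Lower bound.** There is an absolute constant $c>0$ such that for all $n\ge2$ and all $0<\epsilon\le1$, every identity tester in the presence of known noise for $q_1=q_2=$ the uniform distribution on $[n]$ and proximity parameter $\epsilon$ uses at least $c\sqrt n/\epsilon^2$ samples. -/

import Mathlib

namespace MixtureTesting

/-! Distributions on `[n]` are the elements of `stdSimplex ℝ (Fin n)`. -/

/-- The `ℓ₁`-distance of two vectors. -/
def l1Dist {D : Type*} [Fintype D] (p q : D → ℝ) : ℝ := ∑ i, |p i - q i|

/-- The vector `(1 - α) q₁ + α q₂`. -/
def mixture {n : ℕ} (q₁ q₂ : Fin n → ℝ) (α : ℝ) : Fin n → ℝ :=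
  fun i => (1 - α) * q₁ i + α * q₂ i

/-- The set of all mixtures of `q₁` and `q₂`. -/
def mixtures {n : ℕ} (q₁ q₂ : Fin n → ℝ) : Set (Fin n → ℝ) :=
  {p | ∃ α ∈ Set.Icc (0 : ℝ) 1, p = mixture q₁ q₂ α}

/-- The uniform distribution on `[n]`. -/
noncomputable def uniform (n : ℕ) : Fin n → ℝ := fun _ => 1 / (n : ℝ)

/-- A randomized algorithm that draws `m` samples from a distribution on `[n]` and then accepts
(`true`) or rejects (`false`). -/
abbrev SampleAlgorithm (n m : ℕ) : Type := (Fin m → Fin n) → PMF Bool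

/-- The probability that `A` outputs `b` when its `m` samples are drawn independently from `p`
(over the samples and the internal randomness of `A`). -/
noncomputable def outputProb {n m : ℕ} (p : Fin n → ℝ) (A : SampleAlgorithm n m) (b : Bool) : ℝ :=
  ∑ x : Fin m → Fin n, (∏ j, p (x j)) * (A x b).toReal

/-- `A` is an identity tester in the presence of known noise, for the known distributions `q₁`
and `q₂` and the proximity parameter `ε`. -/
def IsMixtureTester {n m : ℕ} (q₁ q₂ : Fin n → ℝ) (ε : ℝ) (A : SampleAlgorithm n m) : Prop :=
  ∀ p ∈ stdSimplex ℝ (Fin n),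
    (p ∈ mixtures q₁ q₂ → 2 / 3 ≤ outputProb p A true) ∧
    ((∀ q ∈ mixtures q₁ q₂, ε ≤ l1Dist p q) → 2 / 3 ≤ outputProb p A false)

/-! ### The learner -/

/-- The elements that are more likely under `q₁` than under `q₂`. -/
noncomputable def heavySet {n : ℕ} (q₁ q₂ : Fin n → ℝ) : Finset (Fin n) :=
  Finset.univ.filter fun i => q₂ i < q₁ i

/-- The fraction of the samples `x` that lie in `S`. -/
noncomputable def empiricalWeight {n m : ℕ} (S : Finset (Fin n)) (x : Fin m → Fin n) : ℝ :=
  ((Finset.univ.filter fun j => x j ∈ S).card : ℝ) / (m : ℝ)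

/-- The learner: it outputs a mixture parameter, computed from the samples `x`. The estimate is
truncated to `[0, 1]`, so that it always is a mixture parameter. -/
noncomputable def mixtureLearner {n m : ℕ} (q₁ q₂ : Fin n → ℝ) (ε : ℝ) (x : Fin m → Fin n) : ℝ :=
  if l1Dist q₁ q₂ < ε then 0
  else
    let S := heavySet q₁ q₂
    max 0 (min 1
      (((∑ i ∈ S, q₁ i) - (empiricalWeight S x + ε / 4)) / ((∑ i ∈ S, q₁ i) - ∑ i ∈ S, q₂ i)))

/-! ### Reshaping -/

/-- The number `a i` of buckets into which `i` is split, for the mixture `qα`. (If `qα = q₂`, the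
second summand is `0`.) -/
noncomputable def buckets {n : ℕ} (qα q₂ : Fin n → ℝ) (i : Fin n) : ℕ :=
  ⌊(n : ℝ) * qα i⌋₊ + ⌊(n : ℝ) * |qα i - q₂ i| / l1Dist qα q₂⌋₊ + 1

instance {n : ℕ} (qα q₂ : Fin n → ℝ) (i : Fin n) : NeZero (buckets qα q₂ i) :=
  ⟨Nat.succ_ne_zero _⟩

/-- The vector on the domain of the pairs `(i, j)`, `j ∈ [a i]`, that splits `p i` equally among
the `a i` buckets of `i`. -/
noncomputable def reshape {n : ℕ} (a : Fin n → ℕ) (p : Fin n → ℝ) : (Σ i, Fin (a i)) → ℝ :=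
  fun d => p d.1 / (a d.1 : ℝ)

/-! ### The `ℓ₂` identity tester -/

/-- The number of occurrences of `d` among the samples `y`. -/
def occurrences {D : Type*} [DecidableEq D] {s : ℕ} (y : Fin s → D) (d : D) : ℕ :=
  (Finset.univ.filter fun j => y j = d).card

/-- The unbiased estimator of `‖p - q‖₂²`, for a known `q` and `s` samples `y` from `p`. -/
noncomputable def l2Statistic {D : Type*} [Fintype D] [DecidableEq D] {s : ℕ}
    (q : D → ℝ) (y : Fin s → D) : ℝ :=
  ∑ d, ((occurrences y d : ℝ) * ((occurrences y d : ℝ) - 1) / ((s : ℝ) * ((s : ℝ) - 1))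
    - 2 * q d * (occurrences y d : ℝ) / (s : ℝ) + q d ^ 2)

/-- The `ℓ₂` identity tester: accept iff the estimate of `‖p - q‖₂²` is at most `ε² / (2 |D|)`. -/
noncomputable def identityTester {D : Type*} [Fintype D] [DecidableEq D] {s : ℕ}
    (q : D → ℝ) (ε : ℝ) (y : Fin s → D) : Bool :=
  decide (l2Statistic q y ≤ ε ^ 2 / (2 * (Fintype.card D : ℝ)))

/-! ### The mixture tester -/

/-- The tester: learn the mixture parameter with accuracy `ε / 6` from the first `m` samples,
replace each of the other `s` samples `i` by `(i, r)` with `r` uniform in `[a i]` (independently),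
and run the `ℓ₂` identity tester for the reshaped `qα` on these. -/
noncomputable def mixtureIdentityTester {n : ℕ} (q₁ q₂ : Fin n → ℝ) (ε : ℝ) (m s : ℕ) :
    SampleAlgorithm n (m + s) := fun x =>
  let α := mixtureLearner q₁ q₂ (ε / 6) fun j : Fin m => x (Fin.castAdd s j)
  let qα := mixture q₁ q₂ α
  let a := buckets qα q₂
  let x' : Fin s → Fin n := fun j => x (Fin.natAdd m j)
  (PMF.uniformOfFintype (∀ j : Fin s, Fin (a (x' j)))).map fun r =>
    identityTester (reshape a qα) ε fun j => (⟨x' j, r j⟩ : Σ i, Fin (a i))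

end MixtureTesting

namespace MixtureTesting

/-! Upper bound. Adding `ε'/4` to the empirical weight makes the learned `α` an underestimate: if `p
= q_β`, then with probability at least 5/6 `α ≤ β` and `(β - α)‖q₁ - q₂‖₁ ≤ ε/6`
(`mixtureLearner_close`). So `p` lies on the segment from `q_α` to `q₂`, and the direction of `p -
q_α` is known even though its length is not. The buckets flatten both `q_α` and that direction:
after reshaping, `p` differs from `q_α` by at most `(ε/6)/n` in each coordinate, hence by at most
`ε²/(36n)` in squared `ℓ₂`. The threshold is at least `ε²/(6n)`, because `|D| ≤ 3n`. If instead `p`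
is `ε`-far from all mixtures, it is far from `q_α` for every `α`, so soundness needs nothing from
the learner: reshaping preserves `ℓ₁`, and Cauchy-Schwarz makes the squared `ℓ₂`-distance at least
twice the threshold. Chebyshev concludes, with the variance from the splitting of the statistic into
a degenerate U-statistic and a linear term (`prodExp_l2Statistic_sub_sq_le`).

Lower bound. The uniform distribution is perturbed by random signs on pairs of points. Telling it
from the average of these far distributions requires a second moment of the likelihood ratio of at
least 10/9 (`chiSq_lower_bound`); that moment is at most `exp(O(kε²/n + (kε²)²/n))`
(`tester_chiSq_bound`). -/

/-- The expectation of `F` over `s` independent samples from `p`. -/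
def prodExp {D : Type*} [Fintype D] (p : D → ℝ) (s : ℕ) (F : (Fin s → D) → ℝ) : ℝ :=
  ∑ y : Fin s → D, (∏ j, p (y j)) * F y

/-! ### Moments of functions of independent samples -/

section prodExp

variable {D : Type*} [Fintype D] {p : D → ℝ} {s : ℕ}

lemma prodExp_add (F G : (Fin s → D) → ℝ) :
    prodExp p s (fun y => F y + G y) = prodExp p s F + prodExp p s G := by
  simp [prodExp, mul_add, Finset.sum_add_distrib]

lemma prodExp_mul_left (c : ℝ) (F : (Fin s → D) → ℝ) :
    prodExp p s (fun y => c * F y) = c * prodExp p s F := by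
  simp only [prodExp, Finset.mul_sum]
  exact Finset.sum_congr rfl fun y _ => by ring

lemma prodExp_mono (hp : ∀ d, 0 ≤ p d) {F G : (Fin s → D) → ℝ} (h : ∀ y, F y ≤ G y) :
    prodExp p s F ≤ prodExp p s G :=
  Finset.sum_le_sum fun y _ => mul_le_mul_of_nonneg_left (h y) (Finset.prod_nonneg fun _ _ => hp _)

lemma prodExp_succ (F : (Fin (s + 1) → D) → ℝ) :
    prodExp p (s + 1) F = ∑ a, p a * prodExp p s fun y => F (Matrix.vecCons a y) := by
  simp only [prodExp, Finset.mul_sum]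
  rw [← Fintype.sum_prod_type', ← (Fin.consEquiv fun _ => D).sum_comp]
  refine Finset.sum_congr rfl fun x _ => ?_
  rw [Fin.prod_univ_succ]
  simp [Fin.consEquiv, Matrix.vecCons, mul_assoc]

lemma prodExp_const (hp : ∑ d, p d = 1) (c : ℝ) : prodExp p s (fun _ => c) = c := by
  induction s with
  | zero => simp [prodExp]
  | succ s ih => rw [prodExp_succ]; simp [ih, ← Finset.sum_mul, hp]

lemma prodExp_not (hp : ∑ d, p d = 1) (P : (Fin s → D) → Prop) [DecidablePred P] :
    prodExp p s (fun y => if P y then 1 else 0) =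
      1 - prodExp p s (fun y => if ¬ P y then 1 else 0) := by
  rw [eq_sub_iff_add_eq, ← prodExp_add]
  refine Eq.trans ?_ (prodExp_const (s := s) hp 1)
  congr 1
  funext y
  split_ifs <;> simp

lemma prodExp_append {m : ℕ} (F : (Fin (m + s) → D) → ℝ) :
    prodExp p (m + s) F = prodExp p m fun x => prodExp p s fun y => F (Fin.append x y) := by
  simp only [prodExp, Finset.mul_sum]
  rw [← Fintype.sum_prod_type', ← (Fin.appendEquiv m s).sum_comp]
  refine Finset.sum_congr rfl fun x _ => ?_
  rw [Fin.prod_univ_add]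
  simp [Fin.appendEquiv, mul_assoc]

/-- Chebyshev's inequality. -/
lemma prodExp_indicator_le (hp : ∀ d, 0 ≤ p d) {F : (Fin s → D) → ℝ} {t : ℝ} (ht : 0 < t)
    (P : (Fin s → D) → Prop) [DecidablePred P] (hP : ∀ y, P y → t ≤ |F y|) :
    prodExp p s (fun y => if P y then 1 else 0) ≤ prodExp p s (fun y => F y ^ 2) / t ^ 2 := by
  rw [div_eq_inv_mul, ← prodExp_mul_left]
  refine prodExp_mono hp fun y => ?_
  split_ifs with h
  · rw [← div_eq_inv_mul, one_le_div (by positivity), ← sq_abs (F y)]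
    exact pow_le_pow_left₀ ht.le (hP y h) 2
  · positivity

lemma sum_mul_sub_mean_sq_le (hp : ∑ d, p d = 1) (f : D → ℝ) :
    ∑ d, p d * (f d - ∑ e, p e * f e) ^ 2 ≤ ∑ d, p d * f d ^ 2 := by
  set μ := ∑ e, p e * f e with hμ
  have : ∑ d, p d * (f d - μ) ^ 2 =
      ∑ d, p d * f d ^ 2 - 2 * μ * ∑ d, p d * f d + μ ^ 2 * ∑ d, p d := by
    simp only [Finset.mul_sum, ← Finset.sum_sub_distrib, ← Finset.sum_add_distrib]
    exact Finset.sum_congr rfl fun d _ => by ring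
  rw [this, hp, ← hμ]
  nlinarith [sq_nonneg μ]

lemma sum_mul_sub_mean (hp : ∑ d, p d = 1) (f : D → ℝ) :
    ∑ d, p d * (f d - ∑ e, p e * f e) = 0 := by
  simp [mul_sub, Finset.sum_sub_distrib, ← Finset.sum_mul, hp]

/-- The second moment of a sum of independent centred variables. -/
lemma prodExp_sum_sq (hp : ∑ d, p d = 1) {l : D → ℝ} (hl : ∑ d, p d * l d = 0) :
    prodExp p s (fun y => (∑ j, l (y j)) ^ 2) = s * ∑ d, p d * l d ^ 2 := by
  induction s with
  | zero => simp [prodExp]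
  | succ s ih =>
    rw [prodExp_succ]
    have h : ∀ a, prodExp p s (fun y => (∑ j, l (Matrix.vecCons a y j)) ^ 2) =
        l a ^ 2 + (2 * prodExp p s fun y => ∑ j, l (y j)) * l a + s * ∑ d, p d * l d ^ 2 := by
      intro a
      rw [← ih]
      simp only [Fin.sum_univ_succ, Matrix.cons_val_zero, Matrix.cons_val_succ]
      conv_lhs => enter [3, y]; rw [show (l a + ∑ j, l (y j)) ^ 2 =
        l a ^ 2 + ((2 * l a) * ∑ j, l (y j) + (∑ j, l (y j)) ^ 2) by ring]
      rw [prodExp_add, prodExp_add, prodExp_const hp, prodExp_mul_left]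
      ring
    simp only [h, mul_add, Finset.sum_add_distrib, ← Finset.sum_mul, hp]
    have : ∀ a, p a * ((2 * prodExp p s fun y => ∑ j, l (y j)) * l a) =
      (2 * prodExp p s fun y => ∑ j, l (y j)) * (p a * l a) := fun a => by ring
    simp only [this, ← Finset.mul_sum, hl]
    push_cast
    ring

/-- The sum of a kernel over all ordered pairs of distinct samples. -/
def offDiagSum (κ : D → D → ℝ) (y : Fin s → D) : ℝ :=
  (∑ j, ∑ k, κ (y j) (y k)) - ∑ j, κ (y j) (y j)

lemma offDiagSum_vecCons {E : Type*} {κ : E → E → ℝ} (hκ : ∀ a b, κ a b = κ b a) (a : E)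
    (y : Fin s → E) :
    offDiagSum κ (Matrix.vecCons a y) = offDiagSum κ y + 2 * ∑ k, κ a (y k) := by
  simp only [offDiagSum, Fin.sum_univ_succ, Matrix.cons_val_zero, Matrix.cons_val_succ,
    Finset.sum_add_distrib, hκ _ a]
  ring

/-- The second moment of a degenerate U-statistic. -/
lemma prodExp_offDiagSum_sq (hp : ∑ d, p d = 1) {κ : D → D → ℝ} (hκ : ∀ a b, κ a b = κ b a)
    (hdeg : ∀ a, ∑ b, p b * κ a b = 0) :
    prodExp p s (fun y => offDiagSum κ y ^ 2) =
      2 * s * (s - 1) * ∑ a, p a * ∑ b, p b * κ a b ^ 2 := by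
  induction s with
  | zero => simp [prodExp, offDiagSum]
  | succ s ih =>
    rw [prodExp_succ]
    have h : ∀ a, prodExp p s (fun y => offDiagSum κ (Matrix.vecCons a y) ^ 2) =
        prodExp p s (fun y => offDiagSum κ y ^ 2) +
          prodExp p s (fun y => 4 * offDiagSum κ y * ∑ k, κ a (y k)) +
          4 * (s * ∑ b, p b * κ a b ^ 2) := by
      intro a
      rw [← prodExp_sum_sq hp (hdeg a), ← prodExp_mul_left, ← prodExp_add, ← prodExp_add]
      congr 1
      funext y
      rw [offDiagSum_vecCons hκ]
      ring
    -- The cross term vanishes: averaging over the new sample first kills the kernel by degeneracy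
    -- and symmetry.
    have hc : ∑ a, p a * prodExp p s (fun y => 4 * offDiagSum κ y * ∑ k, κ a (y k)) = 0 := by
      simp only [prodExp, Finset.mul_sum]
      rw [Finset.sum_comm]
      refine Finset.sum_eq_zero fun y _ => ?_
      rw [Finset.sum_comm]
      refine Finset.sum_eq_zero fun k _ => ?_
      rw [← mul_zero ((∏ j, p (y j)) * (4 * offDiagSum κ y)), ← hdeg (y k), Finset.mul_sum]
      exact Finset.sum_congr rfl fun a _ => by rw [hκ]; ring
    simp only [h, mul_add, Finset.sum_add_distrib, ← Finset.sum_mul, hp, hc, ih]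
    have : ∑ a, p a * (4 * (s * ∑ b, p b * κ a b ^ 2)) =
        4 * s * ∑ a, p a * ∑ b, p b * κ a b ^ 2 := by
      rw [Finset.mul_sum]
      exact Finset.sum_congr rfl fun a _ => by ring
    rw [this]
    push_cast
    ring

end prodExp

/-! ### Mean and variance of the `ℓ₂` statistic -/

section l2Statistic

variable {D : Type*} [Fintype D] [DecidableEq D] {p : D → ℝ} {s : ℕ}

lemma sum_occurrences_mul (f : D → ℝ) (y : Fin s → D) :
    ∑ d, f d * (occurrences y d : ℝ) = ∑ j, f (y j) := by
  simp only [occurrences, Finset.card_filter, Nat.cast_sum, Finset.mul_sum]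
  rw [Finset.sum_comm]
  simp

lemma sum_occurrences_sq (y : Fin s → D) :
    ∑ d, (occurrences y d : ℝ) * (occurrences y d : ℝ) =
      ∑ j, ∑ k, if y j = y k then (1 : ℝ) else 0 := by
  rw [sum_occurrences_mul]
  refine Finset.sum_congr rfl fun j _ => ?_
  rw [occurrences, Finset.card_filter, Nat.cast_sum]
  exact Finset.sum_congr rfl fun k _ => by simp only [eq_comm (a := y j), Nat.cast_ite,
    Nat.cast_one, Nat.cast_zero]

/-- The inner product of the centred indicator vectors of `a` and `b`. -/
def centredKernel (p : D → ℝ) (a b : D) : ℝ :=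
  (if a = b then 1 else 0) - p b - (p a - ∑ d, p d ^ 2)

lemma centredKernel_comm (a b : D) : centredKernel p a b = centredKernel p b a := by
  simp only [centredKernel, eq_comm (a := a)]
  ring

lemma mean_indicator_sub (a : D) :
    ∑ b, p b * ((if a = b then 1 else 0) - p b) = p a - ∑ d, p d ^ 2 := by
  simp [mul_sub, Finset.sum_sub_distrib, sq]

lemma sum_mul_centredKernel (hp : ∑ d, p d = 1) (a : D) :
    ∑ b, p b * centredKernel p a b = 0 := by
  simp only [centredKernel, ← mean_indicator_sub a]
  exact sum_mul_sub_mean hp _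

/-- For fixed `a` the kernel is a centred function of `b`, so its variance is at most the second
moment of the uncentred one; averaging over `a` leaves `∑ p² - ∑ p³`. -/
lemma sum_sum_mul_centredKernel_sq_le (h0 : ∀ d, 0 ≤ p d) (hp : ∑ d, p d = 1) :
    ∑ a, p a * ∑ b, p b * centredKernel p a b ^ 2 ≤ ∑ d, p d ^ 2 := by
  have h : ∀ a, ∑ b, p b * centredKernel p a b ^ 2 ≤ p a - 2 * p a ^ 2 + ∑ b, p b ^ 3 := by
    intro a
    simp only [centredKernel, ← mean_indicator_sub a]
    refine (sum_mul_sub_mean_sq_le hp _).trans_eq ?_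
    have : ∀ b, p b * ((if a = b then 1 else 0) - p b) ^ 2 =
        (if a = b then p b - 2 * p b ^ 2 else 0) + p b ^ 3 := by
      intro b
      split_ifs <;> ring
    simp [this, Finset.sum_add_distrib]
  calc _ ≤ ∑ a, p a * (p a - 2 * p a ^ 2 + ∑ b, p b ^ 3) :=
        Finset.sum_le_sum fun a _ => mul_le_mul_of_nonneg_left (h a) (h0 a)
    _ = ∑ a, p a ^ 2 - 2 * ∑ a, p a ^ 3 + (∑ a, p a) * ∑ b, p b ^ 3 := by
        rw [Finset.mul_sum, Finset.sum_mul, ← Finset.sum_sub_distrib, ← Finset.sum_add_distrib]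
        exact Finset.sum_congr rfl fun a _ => by ring
    _ ≤ _ := by
        rw [hp]
        linarith [Finset.sum_nonneg fun a (_ : a ∈ Finset.univ) => pow_nonneg (h0 a) 3]

/-- Hoeffding decomposition of the error. It shows that the statistic is unbiased, and both terms
have explicit second moments. Two samples are needed for the denominators to be nonzero. -/
lemma l2Statistic_sub (hs : 2 ≤ s) (q : D → ℝ) (y : Fin s → D) :
    l2Statistic q y - ∑ d, (p d - q d) ^ 2 =
      (s * (s - 1) : ℝ)⁻¹ * offDiagSum (centredKernel p) y +
        2 / s * ∑ j, ((p (y j) - q (y j)) - ∑ d, p d * (p d - q d)) := by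
  have h2 : (2 : ℝ) ≤ s := by exact_mod_cast hs
  have h1 : (s : ℝ) ≠ 0 := by linarith
  have h3 : (s : ℝ) - 1 ≠ 0 := by linarith
  have e1 : l2Statistic q y = ((∑ j, ∑ k, if y j = y k then (1 : ℝ) else 0) - s) / (s * (s - 1))
      - 2 / s * ∑ j, q (y j) + ∑ d, q d ^ 2 := by
    have := sum_occurrences_mul (fun _ => 1) y
    simp only [one_mul, Finset.sum_const, Finset.card_univ, Fintype.card_fin, nsmul_eq_mul,
      mul_one] at this
    rw [← sum_occurrences_sq, ← sum_occurrences_mul]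
    nth_rewrite 1 [← this]
    rw [← Finset.sum_sub_distrib, Finset.sum_div, Finset.mul_sum, ← Finset.sum_sub_distrib,
      ← Finset.sum_add_distrib]
    exact Finset.sum_congr rfl fun d _ => by ring
  have e2 : offDiagSum (centredKernel p) y = (∑ j, ∑ k, if y j = y k then (1 : ℝ) else 0) - s
      - 2 * (s - 1) * ∑ j, p (y j) + s * (s - 1) * ∑ d, p d ^ 2 := by
    simp only [offDiagSum, centredKernel, Finset.sum_sub_distrib, Finset.sum_const,
      Finset.card_univ, Fintype.card_fin, nsmul_eq_mul, if_true, ← Finset.mul_sum]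
    ring
  have e3 : ∑ d, (p d - q d) ^ 2 = 2 * ∑ d, p d * (p d - q d) - ∑ d, p d ^ 2 + ∑ d, q d ^ 2 := by
    rw [Finset.mul_sum, ← Finset.sum_sub_distrib, ← Finset.sum_add_distrib]
    exact Finset.sum_congr rfl fun d _ => by ring
  rw [e1, e2, e3]
  simp only [Finset.sum_sub_distrib, Finset.sum_const, Finset.card_univ, Fintype.card_fin,
    nsmul_eq_mul]
  field_simp
  ring

lemma prodExp_l2Statistic_sub_sq_le (h0 : ∀ d, 0 ≤ p d) (hp : ∑ d, p d = 1) (hs : 2 ≤ s)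
    (q : D → ℝ) :
    prodExp p s (fun y => (l2Statistic q y - ∑ d, (p d - q d) ^ 2) ^ 2) ≤
      4 * (∑ d, p d ^ 2) / (s * (s - 1)) + 8 * (∑ d, p d * (p d - q d) ^ 2) / s := by
  have h2 : (2 : ℝ) ≤ s := by exact_mod_cast hs
  have h1 : (0 : ℝ) < s := by linarith
  have h3 : (0 : ℝ) < (s : ℝ) - 1 := by linarith
  calc _ ≤ prodExp p s (fun y => 2 * ((s * (s - 1) : ℝ)⁻¹) ^ 2 * offDiagSum (centredKernel p) y ^ 2
        + 2 * (2 / s) ^ 2 * (∑ j, ((p (y j) - q (y j)) - ∑ d, p d * (p d - q d))) ^ 2) := by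
        refine prodExp_mono h0 fun y => ?_
        rw [l2Statistic_sub hs q y]
        refine (add_sq_le).trans_eq ?_
        ring
    _ = 2 * ((s * (s - 1) : ℝ)⁻¹) ^ 2 *
          (2 * s * (s - 1) * ∑ a, p a * ∑ b, p b * centredKernel p a b ^ 2) +
        2 * (2 / s) ^ 2 * (s * ∑ d, p d * ((p d - q d) - ∑ d, p d * (p d - q d)) ^ 2) := by
        rw [prodExp_add, prodExp_mul_left, prodExp_mul_left,
          prodExp_offDiagSum_sq hp centredKernel_comm (sum_mul_centredKernel hp),
          prodExp_sum_sq (l := fun d => (p d - q d) - ∑ d, p d * (p d - q d)) hp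
            (sum_mul_sub_mean hp _)]
    _ ≤ 2 * ((s * (s - 1) : ℝ)⁻¹) ^ 2 * (2 * s * (s - 1) * ∑ d, p d ^ 2) +
        2 * (2 / s) ^ 2 * (s * ∑ d, p d * (p d - q d) ^ 2) := by
        have := sum_sum_mul_centredKernel_sq_le h0 hp
        have := sum_mul_sub_mean_sq_le hp fun d => p d - q d
        exact add_le_add (by gcongr ?_ * (?_ * ?_)) (by gcongr ?_ * (?_ * ?_))
    _ = _ := by
        field_simp
        ring

end l2Statistic

/-! ### The acceptance probability of the tester -/

/-- Splitting each sample uniformly among its buckets amounts to sampling from the reshaped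
distribution. -/
lemma prodExp_reshape {n s : ℕ} (a : Fin n → ℕ) (p : Fin n → ℝ)
    (F : (Fin s → Σ i, Fin (a i)) → ℝ) :
    prodExp (reshape a p) s F = prodExp p s fun x =>
      ((∏ j, a (x j) : ℕ) : ℝ)⁻¹ * ∑ r : ∀ j, Fin (a (x j)), F fun j => ⟨x j, r j⟩ := by
  let e : (Σ x : Fin s → Fin n, ∀ j, Fin (a (x j))) ≃ (Fin s → Σ i, Fin (a i)) :=
    { toFun := fun z j => ⟨z.1 j, z.2 j⟩
      invFun := fun y => ⟨fun j => (y j).1, fun j => (y j).2⟩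
      left_inv := fun _ => rfl
      right_inv := fun _ => rfl }
  simp only [prodExp, Finset.mul_sum]
  rw [← e.sum_comp, Fintype.sum_sigma]
  refine Finset.sum_congr rfl fun x _ => Finset.sum_congr rfl fun r _ => ?_
  simp only [e, Equiv.coe_fn_mk, reshape, Finset.prod_div_distrib, Nat.cast_prod]
  rw [← mul_assoc, div_eq_mul_inv]

lemma toReal_map_uniformOfFintype {T β : Type*} [Fintype T] [Nonempty T] [DecidableEq β]
    (f : T → β) (b : β) :
    ((PMF.uniformOfFintype T).map f b).toReal =
      (Fintype.card T : ℝ)⁻¹ * ∑ r, if f r = b then 1 else 0 := by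
  rw [PMF.map_apply, tsum_fintype, ENNReal.toReal_sum, Finset.mul_sum]
  · refine Finset.sum_congr rfl fun r _ => ?_
    by_cases h : f r = b
    · simp [h]
    · simp [h, Ne.symm h]
  · intro r _
    split_ifs
    · exact PMF.apply_ne_top _ _
    · simp

lemma outputProb_mixtureIdentityTester {n : ℕ} (p q₁ q₂ : Fin n → ℝ) (ε : ℝ) (m s : ℕ)
    (b : Bool) :
    outputProb p (mixtureIdentityTester q₁ q₂ ε m s) b = prodExp p m fun x =>
      prodExp (reshape (buckets (mixture q₁ q₂ (mixtureLearner q₁ q₂ (ε / 6) x)) q₂) p) s fun y =>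
        if identityTester (reshape (buckets (mixture q₁ q₂ (mixtureLearner q₁ q₂ (ε / 6) x)) q₂)
          (mixture q₁ q₂ (mixtureLearner q₁ q₂ (ε / 6) x))) ε y = b then 1 else 0 := by
  change prodExp p (m + s) _ = _
  rw [prodExp_append]
  congr 1
  funext x
  rw [prodExp_reshape]
  congr 1
  funext x'
  let G : (Fin m → Fin n) → (Fin s → Fin n) → ℝ := fun x x' =>
    let qα := mixture q₁ q₂ (mixtureLearner q₁ q₂ (ε / 6) x)
    ((∏ j, buckets qα q₂ (x' j) : ℕ) : ℝ)⁻¹ * ∑ r : ∀ j, Fin (buckets qα q₂ (x' j)),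
      if identityTester (reshape (buckets qα q₂) qα) ε (fun j => ⟨x' j, r j⟩) = b then 1 else 0
  have key : ∀ z : Fin (m + s) → Fin n, (mixtureIdentityTester q₁ q₂ ε m s z b).toReal =
      G (fun j => z (Fin.castAdd s j)) fun j => z (Fin.natAdd m j) := by
    intro z
    simp only [mixtureIdentityTester, toReal_map_uniformOfFintype, Fintype.card_pi,
      Fintype.card_fin, G]
  rw [key]
  simp only [Fin.append_left, Fin.append_right]
  rfl

/-! ### The `ℓ₂` identity tester -/

section

variable {D : Type*} [Fintype D] [DecidableEq D] {p q : D → ℝ} {s : ℕ} {N ε : ℝ}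

/-- The `+ 1` is the loss from the floor. For `s ≥ 2` it is absorbed by `2(s+1) ≤ 3s` and `2(s+1)² ≤
9s(s-1)`. -/
lemma sample_size_bounds (hN : 0 < N) (hε : 0 < ε) (hs : 2 ≤ s)
    (h : 10000 * (√N / ε ^ 2) < s + 1) :
    20000000 * N ≤ (s * (s - 1) : ℝ) * ε ^ 4 ∧ 6000 * √N ≤ s * ε ^ 2 := by
  have h2 : (2 : ℝ) ≤ s := by exact_mod_cast hs
  have hsq := Real.sq_sqrt hN.le
  have h0 := Real.sqrt_nonneg N
  have hε2 : 0 < ε ^ 2 := by positivity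
  have h' : 10000 * √N < (s + 1) * ε ^ 2 := by
    rw [← mul_div_assoc, div_lt_iff₀ hε2] at h
    exact h
  constructor
  · have h4 : (10000 * √N) ^ 2 ≤ ((s + 1) * ε ^ 2) ^ 2 := by gcongr
    have h5 : 2 * (s + 1 : ℝ) ^ 2 ≤ 9 * (s * (s - 1)) := by nlinarith
    have h6 : 2 * (s + 1 : ℝ) ^ 2 * ε ^ 4 ≤ 9 * (s * (s - 1)) * ε ^ 4 := by gcongr
    nlinarith
  · have h5 : 2 * (s + 1 : ℝ) * ε ^ 2 ≤ 3 * s * ε ^ 2 :=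
      mul_le_mul_of_nonneg_right (by linarith) hε2.le
    linarith

lemma sum_sq_le_mul_sum {E : Type*} [Fintype E] {q : E → ℝ} {c : ℝ}
    (hq0 : ∀ d, 0 ≤ q d) (hq : ∀ d, q d ≤ c) :
    ∑ d, q d ^ 2 ≤ c * ∑ d, q d := by
  rw [Finset.mul_sum]
  exact Finset.sum_le_sum fun d _ => by nlinarith [hq0 d, hq d]

lemma l2Statistic_le_of_lt_two (hs : s < 2) (hq : ∀ d, 0 ≤ q d) (y : Fin s → D) :
    l2Statistic q y ≤ ∑ d, q d ^ 2 := by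
  refine Finset.sum_le_sum fun d _ => ?_
  have h : (s : ℝ) * (s - 1) = 0 := by interval_cases s <;> simp
  rw [h, div_zero]
  have : 0 ≤ 2 * q d * (occurrences y d : ℝ) / s := by have := hq d; positivity
  linarith

/-- The `ℓ₂` tester accepts distributions that are close to `q` in `ℓ₂`. -/
lemma identityTester_accepts [Nonempty D] (hN : 1 ≤ N) (hε : 0 < ε)
    (hp0 : ∀ d, 0 ≤ p d) (hp : ∑ d, p d = 1) (hq0 : ∀ d, 0 ≤ q d) (hq : ∑ d, q d = 1)
    (hD : (Fintype.card D : ℝ) ≤ 3 * N) (hqN : ∀ d, q d ≤ 1 / N) (hpN : ∀ d, p d ≤ 3 / N)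
    (hpq : ∑ d, (p d - q d) ^ 2 ≤ ε ^ 2 / (36 * N)) (hs : 10000 * (√N / ε ^ 2) < s + 1) :
    5 / 6 ≤ prodExp p s fun y => if identityTester q ε y = true then 1 else 0 := by
  have hN0 : 0 < N := by linarith
  have hcard : (0 : ℝ) < Fintype.card D := by exact_mod_cast Fintype.card_pos
  have hthr : ε ^ 2 / (6 * N) ≤ ε ^ 2 / (2 * (Fintype.card D : ℝ)) :=
    div_le_div_of_nonneg_left (by positivity) (by positivity) (by linarith)
  have hsqrt : 1 ≤ √N := Real.one_le_sqrt.2 hN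
  rcases lt_or_ge s 2 with hs2 | hs2
  · have hacc : ∀ y : Fin s → D, identityTester q ε y = true := by
      intro y
      rw [identityTester, decide_eq_true_eq]
      refine (l2Statistic_le_of_lt_two hs2 hq0 y).trans (le_trans ?_ hthr)
      refine (sum_sq_le_mul_sum hq0 hqN).trans ?_
      have h1 : (s : ℝ) ≤ 1 := by exact_mod_cast Nat.lt_succ_iff.1 hs2
      rw [← mul_div_assoc, div_lt_iff₀ (by positivity)] at hs
      rw [hq, mul_one, div_le_div_iff₀ hN0 (by positivity)]
      nlinarith [sq_nonneg ε]
    simp only [hacc, if_true, prodExp_const hp]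
    norm_num
  obtain ⟨hA, hB⟩ := sample_size_bounds hN0 hε hs2 hs
  have h2 : (2 : ℝ) ≤ s := by exact_mod_cast hs2
  have hA0 : (0 : ℝ) < s * (s - 1) := mul_pos (by linarith) (by linarith)
  rw [prodExp_not hp]
  -- The gap between the lower bound `ε²/(6N)` for the threshold and the bound `ε²/(36N)` for the
  -- mean.
  have ht : 0 < 5 * ε ^ 2 / (36 * N) := by positivity
  have hcheb := prodExp_indicator_le hp0 (F := fun y => l2Statistic q y - ∑ d, (p d - q d) ^ 2) ht
    (fun y : Fin s → D => ¬ identityTester q ε y = true) fun y hy => by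
      rw [identityTester, decide_eq_true_eq, not_le] at hy
      refine le_trans ?_ (le_abs_self _)
      have : 5 * ε ^ 2 / (36 * N) = ε ^ 2 / (6 * N) - ε ^ 2 / (36 * N) := by field_simp; ring
      linarith
  have hvar := prodExp_l2Statistic_sub_sq_le hp0 hp hs2 q
  have hP : ∑ d, p d ^ 2 ≤ 3 / N := (sum_sq_le_mul_sum hp0 hpN).trans (by rw [hp, mul_one])
  have hPd : ∑ d, p d * (p d - q d) ^ 2 ≤ 3 / N * (ε ^ 2 / (36 * N)) := by
    refine le_trans ?_ (mul_le_mul_of_nonneg_left hpq (by positivity))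
    rw [Finset.mul_sum]
    exact Finset.sum_le_sum fun d _ => mul_le_mul_of_nonneg_right (hpN d) (sq_nonneg _)
  have hA' : 1 / (s * (s - 1) : ℝ) ≤ ε ^ 4 / (20000000 * N) := by
    rw [div_le_div_iff₀ hA0 (by positivity)]; linarith
  have hB' : 1 / (s : ℝ) ≤ ε ^ 2 / 6000 := by
    rw [div_le_div_iff₀ (by linarith) (by positivity)]; linarith
  have hfin : prodExp p s (fun y => (l2Statistic q y - ∑ d, (p d - q d) ^ 2) ^ 2) ≤
      (5 * ε ^ 2 / (36 * N)) ^ 2 / 6 := by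
    calc _ ≤ 4 * (3 / N) * (1 / (s * (s - 1))) + 8 * (3 / N * (ε ^ 2 / (36 * N))) * (1 / s) := by
          refine hvar.trans ?_
          rw [mul_one_div, mul_one_div]
          gcongr
      _ ≤ 4 * (3 / N) * (ε ^ 4 / (20000000 * N)) +
          8 * (3 / N * (ε ^ 2 / (36 * N))) * (ε ^ 2 / 6000) := by gcongr
      _ = (12 / 20000000 + 24 / 216000) * (ε ^ 4 / N ^ 2) := by field_simp; ring
      _ ≤ (25 / 7776) * (ε ^ 4 / N ^ 2) := by gcongr; norm_num
      _ = _ := by field_simp; ring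
  have : prodExp p s (fun y => (l2Statistic q y - ∑ d, (p d - q d) ^ 2) ^ 2) /
      (5 * ε ^ 2 / (36 * N)) ^ 2 ≤ 1 / 6 := by
    rw [div_le_iff₀ (by positivity)]; linarith
  linarith

/-- Here `r` is the `ℓ₂`-distance. The variance grows with `r`, so it is compared with `r⁴`, the
scale of the squared mean, using that `ε` is at most of order `√N r`. -/
lemma rejection_variance_le {r : ℝ} (hN : 1 ≤ N) (hε : 0 < ε) (hε2 : ε ≤ 2) (hr0 : 0 < r)
    (hεr : ε ^ 2 ≤ 3 * N * r ^ 2) (hεr' : ε ≤ 2 * √N * r) :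
    4 * (2 / N + 2 * r ^ 2) * (ε ^ 4 / (20000000 * N)) +
      8 * ((1 / N + r) * r ^ 2) * (ε ^ 2 / (6000 * √N)) ≤ r ^ 4 / 24 := by
  have hN0 : 0 < N := by linarith
  have hsqrt : 1 ≤ √N := Real.one_le_sqrt.2 hN
  have e1 : ε ^ 4 / N ^ 2 ≤ 9 * r ^ 4 := by
    rw [div_le_iff₀ (by positivity)]
    calc ε ^ 4 = (ε ^ 2) ^ 2 := by ring
      _ ≤ (3 * N * r ^ 2) ^ 2 := by gcongr
      _ = _ := by ring
  have e2 : r ^ 2 * ε ^ 4 / N ≤ 12 * r ^ 4 := by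
    rw [div_le_iff₀ hN0]
    have : ε ^ 2 ≤ 4 := by nlinarith
    calc r ^ 2 * ε ^ 4 = r ^ 2 * ε ^ 2 * ε ^ 2 := by ring
      _ ≤ r ^ 2 * (3 * N * r ^ 2) * 4 := by gcongr
      _ = _ := by ring
  have e3 : r ^ 2 * ε ^ 2 / (N * √N) ≤ 3 * r ^ 4 := by
    rw [div_le_iff₀ (by positivity)]
    calc r ^ 2 * ε ^ 2 ≤ r ^ 2 * (3 * N * r ^ 2) := by gcongr
      _ = 3 * r ^ 4 * (N * 1) := by ring
      _ ≤ _ := by gcongr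
  have e4 : r ^ 3 * ε ^ 2 / √N ≤ 4 * r ^ 4 := by
    rw [div_le_iff₀ (by positivity)]
    calc r ^ 3 * ε ^ 2 = r ^ 3 * ε * ε := by ring
      _ ≤ r ^ 3 * (2 * √N * r) * 2 := by gcongr
      _ = _ := by ring
  calc _ = 8 / 20000000 * (ε ^ 4 / N ^ 2) + 8 / 20000000 * (r ^ 2 * ε ^ 4 / N) +
        8 / 6000 * (r ^ 2 * ε ^ 2 / (N * √N)) + 8 / 6000 * (r ^ 3 * ε ^ 2 / √N) := by
        field_simp; ring
    _ ≤ 8 / 20000000 * (9 * r ^ 4) + 8 / 20000000 * (12 * r ^ 4) +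
        8 / 6000 * (3 * r ^ 4) + 8 / 6000 * (4 * r ^ 4) := by gcongr
    _ ≤ r ^ 4 / 24 := by nlinarith [pow_pos hr0 4]

/-- The `ℓ₂` tester rejects distributions that are far from `q` in `ℓ₁`. -/
lemma identityTester_rejects [Nonempty D] (hN : 1 ≤ N) (hε : 0 < ε) (hε2 : ε ≤ 2)
    (hp0 : ∀ d, 0 ≤ p d) (hp : ∑ d, p d = 1) (hq0 : ∀ d, 0 ≤ q d) (hq : ∑ d, q d = 1)
    (hD : (Fintype.card D : ℝ) ≤ 3 * N) (hqN : ∀ d, q d ≤ 1 / N)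
    (hpq : ε ≤ ∑ d, |p d - q d|) (hs : 10000 * (√N / ε ^ 2) < s + 1) :
    5 / 6 ≤ prodExp p s fun y => if identityTester q ε y = false then 1 else 0 := by
  have hN0 : 0 < N := by linarith
  have hcard : (0 : ℝ) < Fintype.card D := by exact_mod_cast Fintype.card_pos
  have hsqrt : 1 ≤ √N := Real.one_le_sqrt.2 hN
  have hs2 : 2 ≤ s := by
    have h1 : 1 / 4 ≤ √N / ε ^ 2 := by
      rw [div_le_div_iff₀ (by norm_num) (by positivity)]; nlinarith
    have h2 : (2 : ℝ) ≤ s := by linarith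
    exact_mod_cast h2
  obtain ⟨hA, hB⟩ := sample_size_bounds hN0 hε hs2 hs
  have h2 : (2 : ℝ) ≤ s := by exact_mod_cast hs2
  have hA0 : (0 : ℝ) < s * (s - 1) := mul_pos (by linarith) (by linarith)
  set T := ∑ d, (p d - q d) ^ 2 with hT
  have hcs : ε ^ 2 ≤ Fintype.card D * T := by
    refine (pow_le_pow_left₀ hε.le hpq 2).trans ?_
    refine (sq_sum_le_card_mul_sum_sq).trans_eq ?_
    simp [hT]
  have hT0 : 0 < T := by
    by_contra h
    nlinarith [pow_pos hε 2]
  set r := √T with hr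
  have hr0 : 0 < r := Real.sqrt_pos.2 hT0
  have hrT : r ^ 2 = T := Real.sq_sqrt hT0.le
  have hεr : ε ^ 2 ≤ 3 * N * r ^ 2 := by
    rw [hrT]; exact hcs.trans (mul_le_mul_of_nonneg_right hD hT0.le)
  have hεr' : ε ≤ 2 * √N * r := by
    refine (sq_le_sq₀ hε.le (by positivity)).1 ?_
    rw [mul_pow, mul_pow, Real.sq_sqrt hN0.le]
    nlinarith [mul_pos hN0 (pow_pos hr0 2)]
  -- A far `p` has no pointwise bound of order `1/N`; this replaces it by `p d ≤ 1/N + r`.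
  have hδ : ∀ d, |p d - q d| ≤ r := fun d => by
    rw [hr, ← Real.sqrt_sq_eq_abs]
    exact Real.sqrt_le_sqrt (Finset.single_le_sum (f := fun d => (p d - q d) ^ 2)
      (fun _ _ => sq_nonneg _) (Finset.mem_univ d))
  rw [prodExp_not hp]
  have ht : 0 < T / 2 := by positivity
  have hcheb := prodExp_indicator_le hp0 (F := fun y => l2Statistic q y - T) ht
    (fun y : Fin s → D => ¬ identityTester q ε y = false) fun y hy => by
      rw [Bool.not_eq_false, identityTester, decide_eq_true_eq] at hy
      have : ε ^ 2 / (2 * (Fintype.card D : ℝ)) ≤ T / 2 := by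
        rw [div_le_div_iff₀ (by positivity) (by norm_num)]; linarith
      rw [abs_sub_comm]
      exact le_trans (by linarith) (le_abs_self _)
  have hvar := prodExp_l2Statistic_sub_sq_le hp0 hp hs2 q
  have hP : ∑ d, p d ^ 2 ≤ 2 / N + 2 * r ^ 2 := by
    have h1 : ∑ d, q d ^ 2 ≤ 1 / N := (sum_sq_le_mul_sum hq0 hqN).trans (by rw [hq, mul_one])
    calc ∑ d, p d ^ 2 ≤ ∑ d, (2 * q d ^ 2 + 2 * (p d - q d) ^ 2) :=
          Finset.sum_le_sum fun d _ => by nlinarith [sq_nonneg (p d - 2 * q d)]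
      _ = 2 * ∑ d, q d ^ 2 + 2 * T := by
          rw [Finset.sum_add_distrib, ← Finset.mul_sum, ← Finset.mul_sum]
      _ ≤ 2 * (1 / N) + 2 * T := by gcongr
      _ = _ := by rw [hrT]; ring
  have hPd : ∑ d, p d * (p d - q d) ^ 2 ≤ (1 / N + r) * r ^ 2 := by
    rw [hrT, hT, Finset.mul_sum]
    refine Finset.sum_le_sum fun d _ => mul_le_mul_of_nonneg_right ?_ (sq_nonneg _)
    linarith [hqN d, hδ d, le_abs_self (p d - q d)]
  have hA' : 1 / (s * (s - 1) : ℝ) ≤ ε ^ 4 / (20000000 * N) := by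
    rw [div_le_div_iff₀ hA0 (by positivity)]; linarith
  have hB' : 1 / (s : ℝ) ≤ ε ^ 2 / (6000 * √N) := by
    rw [div_le_div_iff₀ (by linarith) (by positivity)]; linarith
  have hfin : prodExp p s (fun y => (l2Statistic q y - T) ^ 2) ≤ (T / 2) ^ 2 / 6 := by
    calc _ ≤ 4 * (2 / N + 2 * r ^ 2) * (1 / (s * (s - 1))) +
          8 * ((1 / N + r) * r ^ 2) * (1 / s) := by
          refine hvar.trans ?_
          rw [mul_one_div, mul_one_div]
          gcongr
      _ ≤ 4 * (2 / N + 2 * r ^ 2) * (ε ^ 4 / (20000000 * N)) +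
          8 * ((1 / N + r) * r ^ 2) * (ε ^ 2 / (6000 * √N)) := by gcongr
      _ ≤ r ^ 4 / 24 := rejection_variance_le hN hε hε2 hr0 hεr hεr'
      _ = _ := by rw [← hrT]; ring
  have : prodExp p s (fun y => (l2Statistic q y - T) ^ 2) / (T / 2) ^ 2 ≤ 1 / 6 := by
    rw [div_le_iff₀ (by positivity)]; linarith
  linarith

end

/-! ### Mixtures and reshaping -/

section

variable {n : ℕ} {q₁ q₂ p q : Fin n → ℝ}

lemma l1Dist_nonneg {D : Type*} [Fintype D] (p q : D → ℝ) : 0 ≤ l1Dist p q :=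
  Finset.sum_nonneg fun _ _ => abs_nonneg _

lemma l1Dist_le_two (hp : p ∈ stdSimplex ℝ (Fin n)) (hq : q ∈ stdSimplex ℝ (Fin n)) :
    l1Dist p q ≤ 2 := by
  calc l1Dist p q ≤ ∑ i, (p i + q i) := Finset.sum_le_sum fun i _ =>
        abs_le.2 ⟨by linarith [hp.1 i, hq.1 i], by linarith [hp.1 i, hq.1 i]⟩
    _ = 2 := by rw [Finset.sum_add_distrib, hp.2, hq.2]; norm_num

lemma mixture_mem_stdSimplex (h₁ : q₁ ∈ stdSimplex ℝ (Fin n)) (h₂ : q₂ ∈ stdSimplex ℝ (Fin n))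
    {α : ℝ} (hα : α ∈ Set.Icc (0 : ℝ) 1) : mixture q₁ q₂ α ∈ stdSimplex ℝ (Fin n) :=
  convex_stdSimplex ℝ (Fin n) h₁ h₂ (sub_nonneg.2 hα.2) hα.1 (by ring)

lemma l1Dist_mixture_right {α : ℝ} (hα : α ≤ 1) :
    l1Dist (mixture q₁ q₂ α) q₂ = (1 - α) * l1Dist q₁ q₂ := by
  simp only [l1Dist, Finset.mul_sum]
  refine Finset.sum_congr rfl fun i _ => ?_
  rw [mixture, ← abs_of_nonneg (sub_nonneg.2 hα), ← abs_mul, abs_of_nonneg (sub_nonneg.2 hα)]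
  congr 1
  ring

/-- `|x| = 2x⁺ - x`, and the differences sum to zero. -/
lemma l1Dist_eq_two_mul (h₁ : q₁ ∈ stdSimplex ℝ (Fin n)) (h₂ : q₂ ∈ stdSimplex ℝ (Fin n)) :
    l1Dist q₁ q₂ = 2 * ((∑ i ∈ heavySet q₁ q₂, q₁ i) - ∑ i ∈ heavySet q₁ q₂, q₂ i) := by
  have h : ∀ i, |q₁ i - q₂ i| = 2 * (if q₂ i < q₁ i then q₁ i - q₂ i else 0) - (q₁ i - q₂ i) := by
    intro i
    split_ifs with h
    · rw [abs_of_pos (sub_pos.2 h)]; ring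
    · rw [abs_of_nonpos (by linarith)]; ring
  simp only [l1Dist, h, Finset.sum_sub_distrib, ← Finset.mul_sum, h₁.2, h₂.2, sub_self, sub_zero,
    ← Finset.sum_filter, heavySet]

lemma sum_sigma_div (a : Fin n → ℕ) (ha : ∀ i, a i ≠ 0) (f : Fin n → ℝ) :
    ∑ d : Σ i, Fin (a i), f d.1 / a d.1 = ∑ i, f i := by
  rw [Fintype.sum_sigma]
  refine Finset.sum_congr rfl fun i _ => ?_
  have : (a i : ℝ) ≠ 0 := by exact_mod_cast ha i
  simp
  field_simp

lemma buckets_ne_zero (i : Fin n) : buckets q q₂ i ≠ 0 := Nat.succ_ne_zero _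

lemma card_buckets_le (hq : q ∈ stdSimplex ℝ (Fin n)) :
    (Fintype.card (Σ i, Fin (buckets q q₂ i)) : ℝ) ≤ 3 * n := by
  rw [Fintype.card_sigma]
  simp only [Fintype.card_fin, Nat.cast_sum]
  calc _ ≤ ∑ i : Fin n, ((n : ℝ) * q i + (n : ℝ) * |q i - q₂ i| / l1Dist q q₂ + 1) := by
        refine Finset.sum_le_sum fun i _ => ?_
        have := l1Dist_nonneg q q₂
        rw [buckets]
        push_cast
        have h1 := Nat.floor_le (mul_nonneg (Nat.cast_nonneg (α := ℝ) n) (hq.1 i))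
        have h2 := Nat.floor_le (show 0 ≤ (n : ℝ) * |q i - q₂ i| / l1Dist q q₂ by positivity)
        linarith
    _ = n * 1 + n * (l1Dist q q₂ / l1Dist q q₂) + n := by
        simp only [mul_div_assoc, Finset.sum_add_distrib, ← Finset.mul_sum, ← Finset.sum_div, hq.2]
        simp [l1Dist]
    _ ≤ _ := by
        have := div_self_le_one (l1Dist q q₂)
        nlinarith [Nat.cast_nonneg (α := ℝ) n]

lemma mul_le_buckets (i : Fin n) : (n : ℝ) * q i ≤ buckets q q₂ i := by
  have := (Nat.lt_floor_add_one ((n : ℝ) * q i)).le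
  rw [buckets]
  push_cast
  linarith [Nat.cast_nonneg (α := ℝ) ⌊(n : ℝ) * |q i - q₂ i| / l1Dist q q₂⌋₊]

/-- The purpose of the second floor in `buckets`: each bucket carries at most a `1/n` share of the
direction `q - q₂`. If `q = q₂`, both sides vanish. -/
lemma mul_abs_sub_le_buckets (i : Fin n) :
    (n : ℝ) * |q i - q₂ i| ≤ buckets q q₂ i * l1Dist q q₂ := by
  rcases (l1Dist_nonneg q q₂).eq_or_lt with h | h
  · have : |q i - q₂ i| ≤ l1Dist q q₂ := Finset.single_le_sum (f := fun i => |q i - q₂ i|)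
      (fun _ _ => abs_nonneg _) (Finset.mem_univ i)
    rw [← h] at this ⊢
    rw [le_antisymm this (abs_nonneg _)]
    simp
  · rw [← div_le_iff₀ h]
    have := (Nat.lt_floor_add_one ((n : ℝ) * |q i - q₂ i| / l1Dist q q₂)).le
    rw [buckets]
    push_cast
    linarith [Nat.cast_nonneg (α := ℝ) ⌊(n : ℝ) * q i⌋₊]

lemma reshape_nonneg (a : Fin n → ℕ) (hq : q ∈ stdSimplex ℝ (Fin n)) (d : Σ i, Fin (a i)) :
    0 ≤ reshape a q d := div_nonneg (hq.1 _) (Nat.cast_nonneg _)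

lemma sum_reshape (a : Fin n → ℕ) (ha : ∀ i, a i ≠ 0) (hq : q ∈ stdSimplex ℝ (Fin n)) :
    ∑ d, reshape a q d = 1 := (sum_sigma_div a ha q).trans hq.2

lemma reshape_buckets_le (hn : 0 < n) (d : Σ i, Fin (buckets q q₂ i)) :
    reshape (buckets q q₂) q d ≤ 1 / n := by
  have h : (0 : ℝ) < buckets q q₂ d.1 := by exact_mod_cast Nat.pos_of_ne_zero (buckets_ne_zero _)
  rw [reshape, div_le_div_iff₀ h (by exact_mod_cast hn)]
  linarith [mul_le_buckets (q := q) (q₂ := q₂) d.1]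

lemma abs_reshape_sub (a : Fin n → ℕ) (d : Σ i, Fin (a i)) :
    |reshape a p d - reshape a q d| = |p d.1 - q d.1| / a d.1 := by
  rw [reshape, reshape, ← sub_div, abs_div, Nat.abs_cast]

lemma sum_abs_reshape_sub (a : Fin n → ℕ) (ha : ∀ i, a i ≠ 0) :
    ∑ d, |reshape a p d - reshape a q d| = l1Dist p q := by
  simp only [abs_reshape_sub]
  exact sum_sigma_div a ha fun i => |p i - q i|

lemma nonempty_buckets (hn : 0 < n) : Nonempty (Σ i, Fin (buckets q q₂ i)) :=
  ⟨⟨⟨0, hn⟩, ⟨0, Nat.succ_pos _⟩⟩⟩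

lemma pos_of_mem_stdSimplex (hq : q ∈ stdSimplex ℝ (Fin n)) : 0 < n := by
  rcases Nat.eq_zero_or_pos n with rfl | h
  · simpa using hq.2
  · exact h

lemma abs_mixture_sub_left {t : ℝ} (ht : 0 ≤ t) (i : Fin n) :
    |mixture q q₂ t i - q i| = t * |q i - q₂ i| := by
  rw [mixture, show (1 - t) * q i + t * q₂ i - q i = -(t * (q i - q₂ i)) by ring, abs_neg, abs_mul,
    abs_of_nonneg ht]

lemma reshaped_tester_accepts {s : ℕ} {ε t : ℝ} (hε : 0 < ε) (hq : q ∈ stdSimplex ℝ (Fin n))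
    (hq₂ : q₂ ∈ stdSimplex ℝ (Fin n)) (ht : t ∈ Set.Icc (0 : ℝ) 1)
    (hclose : t * l1Dist q q₂ ≤ ε / 6) (hs : 10000 * (√n / ε ^ 2) < s + 1) :
    5 / 6 ≤ prodExp (reshape (buckets q q₂) (mixture q q₂ t)) s fun y =>
      if identityTester (reshape (buckets q q₂) q) ε y = true then 1 else 0 := by
  have hn := pos_of_mem_stdSimplex hq
  have hn' : (0 : ℝ) < n := by exact_mod_cast hn
  have hp := mixture_mem_stdSimplex hq hq₂ ht
  have := nonempty_buckets (q := q) (q₂ := q₂) hn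
  have ha := buckets_ne_zero (q := q) (q₂ := q₂)
  have hL := l1Dist_nonneg q q₂
  have hdiff : ∀ d, |reshape (buckets q q₂) (mixture q q₂ t) d - reshape (buckets q q₂) q d| ≤
      t * l1Dist q q₂ / n := by
    intro d
    have h : (0 : ℝ) < buckets q q₂ d.1 := by exact_mod_cast Nat.pos_of_ne_zero (ha _)
    rw [abs_reshape_sub, abs_mixture_sub_left ht.1, div_le_div_iff₀ h hn']
    nlinarith [mul_le_mul_of_nonneg_left (mul_abs_sub_le_buckets (q := q) (q₂ := q₂) d.1) ht.1]
  have hl1 : l1Dist (mixture q q₂ t) q = t * l1Dist q q₂ := by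
    simp only [l1Dist, abs_mixture_sub_left ht.1, Finset.mul_sum]
  refine identityTester_accepts (N := n) (by exact_mod_cast hn) hε (reshape_nonneg _ hp)
    (sum_reshape _ ha hp) (reshape_nonneg _ hq) (sum_reshape _ ha hq) (card_buckets_le hq)
    (reshape_buckets_le hn) (fun d => ?_) ?_ hs
  · have h1 := (le_abs_self _).trans (hdiff d)
    have h2 : t * l1Dist q q₂ / n ≤ 2 / n := by
      gcongr
      nlinarith [ht.2, l1Dist_le_two hq hq₂]
    have h3 := reshape_buckets_le (q₂ := q₂) (q := q) hn d
    have h4 : (3 : ℝ) / n = 2 / n + 1 / n := by ring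
    linarith
  · calc _ ≤ t * l1Dist q q₂ / n *
          ∑ d, |reshape (buckets q q₂) (mixture q q₂ t) d - reshape (buckets q q₂) q d| := by
          rw [Finset.mul_sum]
          refine Finset.sum_le_sum fun d _ => ?_
          rw [← sq_abs, sq]
          exact mul_le_mul_of_nonneg_right (hdiff d) (abs_nonneg _)
      _ = (t * l1Dist q q₂) ^ 2 / n := by rw [sum_abs_reshape_sub _ ha, hl1]; ring
      _ ≤ (ε / 6) ^ 2 / n := by
          have := mul_nonneg ht.1 hL
          gcongr
      _ = _ := by field_simp; norm_num

lemma reshaped_tester_rejects {s : ℕ} {ε : ℝ} (hε : 0 < ε) (hp : p ∈ stdSimplex ℝ (Fin n))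
    (hq : q ∈ stdSimplex ℝ (Fin n)) (hfar : ε ≤ l1Dist p q)
    (hs : 10000 * (√n / ε ^ 2) < s + 1) :
    5 / 6 ≤ prodExp (reshape (buckets q q₂) p) s fun y =>
      if identityTester (reshape (buckets q q₂) q) ε y = false then 1 else 0 := by
  have hn := pos_of_mem_stdSimplex hq
  have := nonempty_buckets (q := q) (q₂ := q₂) hn
  have ha := buckets_ne_zero (q := q) (q₂ := q₂)
  refine identityTester_rejects (N := n) (by exact_mod_cast hn) hε
    (hfar.trans (l1Dist_le_two hp hq)) (reshape_nonneg _ hp)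
    (sum_reshape _ ha hp) (reshape_nonneg _ hq) (sum_reshape _ ha hq) (card_buckets_le hq)
    (reshape_buckets_le hn) ?_ hs
  rwa [sum_abs_reshape_sub _ ha]

/-! ### The learner -/

lemma mixtureLearner_mem_Icc {m : ℕ} (ε : ℝ) (x : Fin m → Fin n) :
    mixtureLearner q₁ q₂ ε x ∈ Set.Icc (0 : ℝ) 1 := by
  rw [mixtureLearner]
  split_ifs
  · simp
  · exact ⟨le_max_left _ _, max_le zero_le_one (min_le_left _ _)⟩

/-- If the empirical weight of the heavy set is accurate, the true mixture parameter is at least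
the learned one, and close to it. -/
lemma mixtureLearner_close {m : ℕ} {ε β : ℝ} (hε : 0 < ε) (h₁ : q₁ ∈ stdSimplex ℝ (Fin n))
    (h₂ : q₂ ∈ stdSimplex ℝ (Fin n)) (hβ : β ∈ Set.Icc (0 : ℝ) 1) (x : Fin m → Fin n)
    (hx : ε ≤ l1Dist q₁ q₂ →
      |empiricalWeight (heavySet q₁ q₂) x - ∑ i ∈ heavySet q₁ q₂, mixture q₁ q₂ β i| ≤ ε / 4) :
    mixtureLearner q₁ q₂ ε x ≤ β ∧ (β - mixtureLearner q₁ q₂ ε x) * l1Dist q₁ q₂ ≤ ε := by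
  have hL := l1Dist_nonneg q₁ q₂
  rw [mixtureLearner]
  split_ifs with h
  · exact ⟨hβ.1, by nlinarith [hβ.2]⟩
  · have hx := abs_le.1 (hx (not_lt.1 h))
    have hl := l1Dist_eq_two_mul h₁ h₂
    simp only [mixture, Finset.sum_add_distrib, ← Finset.mul_sum] at hx
    simp only
    set A := ∑ i ∈ heavySet q₁ q₂, q₁ i
    set B := ∑ i ∈ heavySet q₁ q₂, q₂ i
    set w := empiricalWeight (heavySet q₁ q₂) x
    have hAB : 0 < A - B := by linarith
    set c := (A - (w + ε / 4)) / (A - B) with hc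
    have hc' : c * (A - B) = A - (w + ε / 4) := div_mul_cancel₀ _ hAB.ne'
    -- The shift `ε/4` equals the permitted error of `w`, so the estimate cannot overshoot.
    have hcβ : c ≤ β := by
      rw [hc, div_le_iff₀ hAB]
      nlinarith
    have hle : max 0 (min 1 c) ≤ β := max_le hβ.1 ((min_le_right _ _).trans hcβ)
    refine ⟨hle, ?_⟩
    have hmin : min 1 c = c := min_eq_right (hcβ.trans hβ.2)
    rw [hmin, hl]
    -- Truncation at 0 only reduces the gap. Untruncated, the error of `w` and the shift total at
    -- most `ε/2`, doubled by `l1Dist = 2(A - B)`.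
    have : (β - max 0 c) * (2 * (A - B)) ≤ (β - c) * (2 * (A - B)) :=
      mul_le_mul_of_nonneg_right (by linarith [le_max_right 0 c]) (by linarith)
    nlinarith

/-- Re-parametrises the segment from `q_α` to `q₂` with `t = (β - α)/(1 - α)`; `α = 1` forces `β =
1` and is treated apart. -/
lemma exists_mixture_of_close {α β ε : ℝ} (hε : 0 < ε) (hα : α ∈ Set.Icc (0 : ℝ) 1) (hβ : β ≤ 1)
    (hαβ : α ≤ β) (h : (β - α) * l1Dist q₁ q₂ ≤ ε) :
    ∃ t ∈ Set.Icc (0 : ℝ) 1, mixture q₁ q₂ β = mixture (mixture q₁ q₂ α) q₂ t ∧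
      t * l1Dist (mixture q₁ q₂ α) q₂ ≤ ε := by
  rcases hα.2.eq_or_lt with rfl | hlt
  · obtain rfl : β = 1 := le_antisymm hβ hαβ
    refine ⟨0, by simp, ?_, by simpa using hε.le⟩
    funext i
    simp [mixture]
  · have h1 : 0 < 1 - α := sub_pos.2 hlt
    refine ⟨(β - α) / (1 - α), ⟨div_nonneg (sub_nonneg.2 hαβ) h1.le, ?_⟩, ?_, ?_⟩
    · rw [div_le_one h1]; linarith
    · funext i
      simp only [mixture]
      field_simp
      ring
    · rw [l1Dist_mixture_right hα.2, ← mul_assoc, div_mul_cancel₀ _ h1.ne']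
      exact h

lemma empiricalWeight_deviation_le {m : ℕ} (hm : 0 < m) (hp : p ∈ stdSimplex ℝ (Fin n))
    (S : Finset (Fin n)) {t : ℝ} (ht : 0 < t) :
    prodExp p m (fun x => if ¬ |empiricalWeight S x - ∑ i ∈ S, p i| ≤ t then 1 else 0) ≤
      1 / (m * t ^ 2) := by
  have hm' : (0 : ℝ) < m := by exact_mod_cast hm
  let f : Fin n → ℝ := fun i => if i ∈ S then 1 else 0
  have hmean : ∑ i, p i * f i = ∑ i ∈ S, p i := by simp [f]
  have hF : ∀ x : Fin m → Fin n, (m : ℝ) * (empiricalWeight S x - ∑ i ∈ S, p i) =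
      ∑ j, (f (x j) - ∑ i, p i * f i) := by
    intro x
    rw [hmean, Finset.sum_sub_distrib, empiricalWeight, mul_sub, mul_div_cancel₀ _ hm'.ne']
    simp [f]
  refine (prodExp_indicator_le hp.1 (F := fun x : Fin m → Fin n => ∑ j, (f (x j) - ∑ i, p i * f i))
    (mul_pos hm' ht) _ fun x hx => ?_).trans ?_
  · rw [← hF, abs_mul, Nat.abs_cast]
    exact mul_le_mul_of_nonneg_left (not_le.1 hx).le hm'.le
  · rw [prodExp_sum_sq (l := fun d => f d - ∑ i, p i * f i) hp.2 (sum_mul_sub_mean hp.2 f)]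
    have h1 : ∑ d, p d * (f d - ∑ i, p i * f i) ^ 2 ≤ 1 := by
      refine (sum_mul_sub_mean_sq_le hp.2 f).trans ?_
      rw [← hp.2]
      refine Finset.sum_le_sum fun i _ => mul_le_of_le_one_right (hp.1 i) ?_
      simp only [f]
      split_ifs <;> simp
    calc _ ≤ (m : ℝ) * 1 / (m * t) ^ 2 := by gcongr
      _ = _ := by field_simp

/-- The upper bound. -/
lemma isMixtureTester_mixtureIdentityTester {ε : ℝ} (hε : 0 < ε) {m s : ℕ}
    (h₁ : q₁ ∈ stdSimplex ℝ (Fin n)) (h₂ : q₂ ∈ stdSimplex ℝ (Fin n))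
    (hm : 10000 / ε ^ 2 < m + 1) (hs : 10000 * (√n / ε ^ 2) < s + 1) :
    IsMixtureTester q₁ q₂ ε (mixtureIdentityTester q₁ q₂ ε m s) := by
  intro p hp
  constructor
  · rintro ⟨β, hβ, hpβ⟩
    rw [outputProb_mixtureIdentityTester]
    let good : (Fin m → Fin n) → Prop := fun x => ε / 6 ≤ l1Dist q₁ q₂ →
      |empiricalWeight (heavySet q₁ q₂) x - ∑ i ∈ heavySet q₁ q₂, p i| ≤ ε / 24
    classical
    have hgood : 5 / 6 ≤ prodExp p m (fun x => if good x then 1 else 0) := by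
      by_cases hl : ε / 6 ≤ l1Dist q₁ q₂
      -- The learner samples only matter if `ε/6 ≤ ‖q₁ - q₂‖₁ ≤ 2`; this bound on `ε` ensures `m >
      -- 0`.
      · have hε12 : ε ≤ 12 := by linarith [l1Dist_le_two h₁ h₂]
        have hε2 : ε ^ 2 ≤ 144 := by nlinarith
        rw [div_lt_iff₀ (by positivity)] at hm
        have hm0 : 0 < m := by
          rcases Nat.eq_zero_or_pos m with rfl | h
          · norm_num at hm; linarith
          · exact h
        have hm1 : (1 : ℝ) ≤ m := by exact_mod_cast hm0
        have hdev := empiricalWeight_deviation_le hm0 hp (heavySet q₁ q₂)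
          (show 0 < ε / 24 by positivity)
        have h6 : 1 / (m * (ε / 24) ^ 2) ≤ 1 / 6 := by
          apply one_div_le_one_div_of_le (by norm_num)
          nlinarith [sq_nonneg ε]
        rw [prodExp_not hp.2]
        simp only [good, hl, true_implies]
        linarith
      · simp only [good, hl, false_implies, if_true, prodExp_const hp.2]
        norm_num
    -- The phases use independent samples, so their success probabilities multiply.
    calc (2 / 3 : ℝ) ≤ 5 / 6 * (5 / 6) := by norm_num
      _ ≤ 5 / 6 * prodExp p m (fun x => if good x then 1 else 0) := by gcongr
      _ = prodExp p m (fun x => 5 / 6 * if good x then 1 else 0) := (prodExp_mul_left _ _).symm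
      _ ≤ _ := prodExp_mono hp.1 fun x => ?_
    have hα := mixtureLearner_mem_Icc (q₁ := q₁) (q₂ := q₂) (ε / 6) x
    split_ifs with hx
    · subst hpβ
      obtain ⟨hle, hcl⟩ := mixtureLearner_close (show 0 < ε / 6 by positivity) h₁ h₂ hβ x
        fun h => (hx h).trans_eq (by ring)
      obtain ⟨t, ht, hmix, htl⟩ := exists_mixture_of_close (by positivity) hα hβ.2 hle hcl
      rw [mul_one]
      have := reshaped_tester_accepts hε (mixture_mem_stdSimplex h₁ h₂ hα) h₂ ht htl hs
      rwa [← hmix] at this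
    · rw [mul_zero]
      refine Finset.sum_nonneg fun y _ => mul_nonneg
        (Finset.prod_nonneg fun _ _ => reshape_nonneg _ hp _) ?_
      dsimp only
      split_ifs <;> norm_num
  · intro hfar
    rw [outputProb_mixtureIdentityTester]
    calc (2 / 3 : ℝ) ≤ 5 / 6 := by norm_num
      _ = prodExp p m (fun _ => 5 / 6) := (prodExp_const hp.2 _).symm
      _ ≤ _ := prodExp_mono hp.1 fun x => ?_
    have hα := mixtureLearner_mem_Icc (q₁ := q₁) (q₂ := q₂) (ε / 6) x
    exact reshaped_tester_rejects hε hp (mixture_mem_stdSimplex h₁ h₂ hα)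
      (hfar _ ⟨_, hα, rfl⟩) hs

end

/-! ### The lower bound -/

lemma prodExp_prod {D : Type*} [Fintype D] (p h : D → ℝ) (s : ℕ) :
    prodExp p s (fun y => ∏ j, h (y j)) = (∑ d, p d * h d) ^ s := by
  induction s with
  | zero => simp [prodExp]
  | succ s ih =>
    rw [prodExp_succ]
    simp only [Fin.prod_univ_succ, Matrix.cons_val_zero, Matrix.cons_val_succ, prodExp_mul_left,
      ih, ← mul_assoc, ← Finset.sum_mul]
    ring

lemma prodExp_sum {D Z : Type*} [Fintype D] [Fintype Z] (p : D → ℝ) (s : ℕ)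
    (F : Z → (Fin s → D) → ℝ) :
    prodExp p s (fun y => ∑ z, F z y) = ∑ z, prodExp p s (F z) := by
  simp only [prodExp, Finset.mul_sum]
  rw [Finset.sum_comm]

lemma toReal_false_add_true (P : PMF Bool) : (P false).toReal + (P true).toReal = 1 := by
  rw [← ENNReal.toReal_add (P.apply_ne_top _) (P.apply_ne_top _), add_comm]
  have := P.tsum_coe
  rw [tsum_fintype, Fintype.sum_bool] at this
  rw [this, ENNReal.toReal_one]

lemma sum_uniform {n : ℕ} (hn : 0 < n) : ∑ i, uniform n i = 1 := by
  have : (n : ℝ) ≠ 0 := by exact_mod_cast hn.ne'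
  simp [uniform, this]

/-- An algorithm that accepts the uniform distribution and rejects every member of a family of
perturbations of it needs the family to have a large average `χ²`-divergence. -/
lemma chiSq_lower_bound {n k : ℕ} (hn : 0 < n) {Z : Type*} [Fintype Z] [Nonempty Z]
    (g : Z → Fin n → ℝ) (hg : ∀ z, ∑ i, g z i = 0) (A : SampleAlgorithm n k)
    (hacc : 2 / 3 ≤ outputProb (uniform n) A true)
    (hrej : ∀ z, 2 / 3 ≤ outputProb (fun i => uniform n i * (1 + g z i)) A false) :
    10 / 9 * (Fintype.card Z : ℝ) ^ 2 ≤
      ∑ z, ∑ z', (∑ i, uniform n i * ((1 + g z i) * (1 + g z' i))) ^ k := by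
  set M : ℝ := (Fintype.card Z : ℝ)
  have hM : 0 < M := Nat.cast_pos.2 Fintype.card_pos
  have hu := sum_uniform hn
  have hu0 : ∀ i, 0 ≤ uniform n i := fun i => by simp [uniform]
  let f : (Fin k → Fin n) → ℝ := fun x => (A x false).toReal
  have hf0 : ∀ x, 0 ≤ f x := fun x => ENNReal.toReal_nonneg
  have hf1 : ∀ x, f x ≤ 1 := fun x => by
    have := toReal_false_add_true (A x)
    have : 0 ≤ (A x true).toReal := ENNReal.toReal_nonneg
    simp only [f]
    linarith
  -- `R / M` is the likelihood ratio of the averaged perturbed sample to the uniform one.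
  let R : (Fin k → Fin n) → ℝ := fun x => ∑ z, ∏ j, (1 + g z (x j))
  have hUf : prodExp (uniform n) k f ≤ 1 / 3 := by
    have : prodExp (uniform n) k f + outputProb (uniform n) A true = 1 := by
      change _ + prodExp (uniform n) k (fun x => (A x true).toReal) = 1
      rw [← prodExp_add]
      simp only [f, toReal_false_add_true, prodExp_const hu]
    linarith
  have hRf : 2 / 3 * M ≤ prodExp (uniform n) k (fun x => R x * f x) := by
    have : prodExp (uniform n) k (fun x => R x * f x) =
        ∑ z, outputProb (fun i => uniform n i * (1 + g z i)) A false := by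
      simp only [R, Finset.sum_mul, prodExp_sum]
      refine Finset.sum_congr rfl fun z _ => Finset.sum_congr rfl fun x _ => ?_
      simp only [Finset.prod_mul_distrib, f]
      ring
    rw [this]
    refine le_trans (le_of_eq ?_) (Finset.sum_le_sum fun z _ => hrej z)
    simp [M, mul_comm]
  have hR : prodExp (uniform n) k R = M := by
    have h : ∀ z, ∑ i, uniform n i * (1 + g z i) = 1 := fun z => by
      simp only [mul_add, mul_one, Finset.sum_add_distrib, hu]
      simp only [uniform, ← Finset.mul_sum, hg, mul_zero, add_zero]
    have hz : ∀ z, prodExp (uniform n) k (fun x => ∏ j, (1 + g z (x j))) = 1 := fun z => by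
      rw [prodExp_prod _ (fun i => 1 + g z i), h, one_pow]
    simp [R, prodExp_sum, hz, M]
  have hR2 : prodExp (uniform n) k (fun x => R x ^ 2) =
      ∑ z, ∑ z', (∑ i, uniform n i * ((1 + g z i) * (1 + g z' i))) ^ k := by
    simp only [R, sq, Finset.sum_mul_sum, prodExp_sum, ← Finset.prod_mul_distrib]
    exact Finset.sum_congr rfl fun z _ => Finset.sum_congr rfl fun z' _ =>
      prodExp_prod _ (fun i => (1 + g z i) * (1 + g z' i)) k
  rw [← hR2]
  have hmono : prodExp (uniform n) k (fun x => R x * f x + (-M) * f x) ≤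
      prodExp (uniform n) k (fun x => 3 / (2 * M) * R x ^ 2 + ((-3) * R x + 5 / 3 * M)) := by
    refine prodExp_mono hu0 fun x => ?_
    -- Weighted AM-GM in place of Cauchy-Schwarz. The weights suit the advantage `M/3` and give `E
    -- (R - M)² ≥ M²/9`.
    have h1 : (R x - M) * f x ≤ 3 / (2 * M) * (R x - M) ^ 2 + M / 6 * f x ^ 2 := by
      have : 3 / (2 * M) * (R x - M) ^ 2 + M / 6 * f x ^ 2 - (R x - M) * f x =
          (3 * (R x - M) - M * f x) ^ 2 / (6 * M) := by field_simp; ring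
      have : 0 ≤ (3 * (R x - M) - M * f x) ^ 2 / (6 * M) := by positivity
      linarith
    have h2 : M / 6 * f x ^ 2 ≤ M / 6 * 1 := by
      gcongr
      exact pow_le_one₀ (hf0 x) (hf1 x)
    have h3 : 3 / (2 * M) * (R x - M) ^ 2 + M / 6 =
        3 / (2 * M) * R x ^ 2 + ((-3) * R x + 5 / 3 * M) := by
      field_simp; ring
    linarith
  rw [prodExp_add, prodExp_mul_left, prodExp_add, prodExp_add, prodExp_mul_left, prodExp_mul_left,
    prodExp_const hu, hR] at hmono
  have h4 : 5 / 3 * M ≤ 3 / (2 * M) * prodExp (uniform n) k (fun x => R x ^ 2) := by nlinarith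
  rw [div_mul_eq_mul_div 3, le_div_iff₀ (by positivity)] at h4
  nlinarith

/-! ### Random sign perturbations of the uniform distribution -/

/-- The sign of a bit. -/
def bitSign (b : Bool) : ℝ := if b then 1 else -1

lemma abs_bitSign (b : Bool) : |bitSign b| = 1 := by cases b <;> simp [bitSign]

/-- The sum factorises over coordinates, and each factor is `eᵗ + e⁻ᵗ` whatever the sign of `z l`.
-/
lemma sum_exp_bitSign (N : ℕ) (t : ℝ) (z : Fin N → Bool) :
    ∑ z' : Fin N → Bool, Real.exp (t * ∑ l, bitSign (z l) * bitSign (z' l)) =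
      (2 * Real.cosh t) ^ N := by
  simp only [Finset.mul_sum, Real.exp_sum]
  have h := Finset.prod_univ_sum (fun _ : Fin N => (Finset.univ : Finset Bool))
    (fun l b => Real.exp (t * (bitSign (z l) * bitSign b)))
  rw [Fintype.piFinset_univ] at h
  rw [← h]
  have : ∀ l, ∑ b, Real.exp (t * (bitSign (z l) * bitSign b)) = 2 * Real.cosh t := by
    intro l
    rw [Real.cosh_eq, Fintype.sum_bool]
    cases z l <;> simp [bitSign] <;> ring
  simp only [this, Finset.prod_const, Finset.card_univ, Fintype.card_fin]

/-- The perturbation of the uniform distribution that is a fixed vector `w` on a few coordinates,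
and is determined by independent signs on pairs of the others. -/
def pairPerturbation {n o N : ℕ} (e : Fin n ≃ Fin o ⊕ (Fin N × Bool)) (w : Fin o → ℝ)
    (z : Fin N → Bool) (i : Fin n) : ℝ :=
  Sum.elim w (fun x => bitSign (z x.1) * bitSign x.2) (e i)

section pairPerturbation

variable {n o N : ℕ} (e : Fin n ≃ Fin o ⊕ (Fin N × Bool)) (w : Fin o → ℝ)

lemma sum_comp_pairPerturbation (z z' : Fin N → Bool) (F : ℝ → ℝ → ℝ) :
    ∑ i, F (pairPerturbation e w z i) (pairPerturbation e w z' i) = ∑ j, F (w j) (w j) +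
      ∑ l, (F (bitSign (z l)) (bitSign (z' l)) + F (-bitSign (z l)) (-bitSign (z' l))) := by
  simp only [pairPerturbation]
  rw [e.sum_comp fun a => F (Sum.elim w (fun x => bitSign (z x.1) * bitSign x.2) a)
    (Sum.elim w (fun x => bitSign (z' x.1) * bitSign x.2) a)]
  simp [Fintype.sum_prod_type, bitSign]

lemma sum_pairPerturbation (hw : ∑ j, w j = 0) (z : Fin N → Bool) :
    ∑ i, pairPerturbation e w z i = 0 := by
  have := sum_comp_pairPerturbation e w z z fun a _ => a
  simpa [hw] using this

lemma sum_pairPerturbation_mul (z z' : Fin N → Bool) :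
    ∑ i, pairPerturbation e w z i * pairPerturbation e w z' i =
      ∑ j, w j ^ 2 + 2 * ∑ l, bitSign (z l) * bitSign (z' l) := by
  rw [sum_comp_pairPerturbation e w z z' fun a b => a * b, Finset.mul_sum]
  simp only [sq, neg_mul_neg, two_mul]

lemma card_eq_of_pair_equiv (e : Fin n ≃ Fin o ⊕ (Fin N × Bool)) : n = o + 2 * N := by
  have := Fintype.card_congr e
  simpa [mul_comm] using this

lemma le_sum_abs_pairPerturbation (hw : (o : ℝ) ≤ ∑ j, |w j|) (z : Fin N → Bool) :
    (n : ℝ) ≤ ∑ i, |pairPerturbation e w z i| := by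
  have h := sum_comp_pairPerturbation e w z z fun a _ => |a|
  simp only [abs_neg, abs_bitSign, Finset.sum_const, Finset.card_univ, Fintype.card_fin,
    nsmul_eq_mul] at h
  have hn : (n : ℝ) = o + 2 * N := by exact_mod_cast card_eq_of_pair_equiv e
  rw [h]
  linarith

lemma neg_one_le_pairPerturbation (hw : ∀ j, -1 ≤ w j) (z : Fin N → Bool) (i : Fin n) :
    -1 ≤ pairPerturbation e w z i := by
  rw [pairPerturbation]
  rcases e i with j | ⟨l, b⟩
  · exact hw j
  · refine (abs_le.1 ?_).1
    simp [abs_mul, abs_bitSign]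

end pairPerturbation

/-- For odd `n` three points stay unpaired and get `(2, -1, -1)`: sum zero, `ℓ₁`-norm 4 ≥ 3, squares
summing to 6, and no entry below -1, so that the perturbed masses stay nonnegative. -/
lemma exists_pairing {n : ℕ} (hn : 2 ≤ n) :
    ∃ (o N : ℕ) (_ : Fin n ≃ Fin o ⊕ (Fin N × Bool)) (w : Fin o → ℝ),
      ∑ j, w j = 0 ∧ (o : ℝ) ≤ ∑ j, |w j| ∧ (∀ j, -1 ≤ w j) ∧ ∑ j, w j ^ 2 ≤ 6 := by
  rcases Nat.even_or_odd' n with ⟨N, rfl | rfl⟩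
  · exact ⟨0, N, Fintype.equivOfCardEq (by simp [mul_comm]), 0, by simp⟩
  · obtain ⟨K, rfl⟩ : ∃ K, N = K + 1 := ⟨N - 1, by omega⟩
    refine ⟨3, K, Fintype.equivOfCardEq (by simp; ring), ![2, -1, -1], ?_, ?_, ?_, ?_⟩
    · simp [Fin.sum_univ_succ]; norm_num
    · simp [Fin.sum_univ_succ]; norm_num
    · intro j
      fin_cases j <;> norm_num
    · simp [Fin.sum_univ_succ]; norm_num

lemma mixture_self {n : ℕ} (q : Fin n → ℝ) (α : ℝ) : mixture q q α = q := by
  funext i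
  simp only [mixture]
  ring

/-- `1 + x ≤ eˣ` turns the `k`-th powers into exponentials of sign correlations. Their average is
`cosh(t)^N ≤ exp(N t²/2)` with `N ≤ n/2`; the unpaired points contribute the term with 6. -/
lemma tester_chiSq_bound {n k : ℕ} {ε : ℝ} (hn : 2 ≤ n) (hε : 0 < ε) (hε1 : ε ≤ 1)
    (A : SampleAlgorithm n k) (hA : IsMixtureTester (uniform n) (uniform n) ε A) :
    10 / 9 ≤ Real.exp (6 * (k * ε ^ 2) / n + (k * ε ^ 2) ^ 2 / n) := by
  obtain ⟨o, N, e, w, hw0, hwabs, hwneg, hw2⟩ := exists_pairing hn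
  have hn0 : 0 < n := by omega
  have hn' : (0 : ℝ) < n := by exact_mod_cast hn0
  have hu := sum_uniform hn0
  set g : (Fin N → Bool) → Fin n → ℝ := fun z i => ε * pairPerturbation e w z i with hgdef
  have hg : ∀ z, ∑ i, g z i = 0 := fun z => by
    simp only [g, ← Finset.mul_sum, sum_pairPerturbation e w hw0, mul_zero]
  have hg1 : ∀ z i, 0 ≤ 1 + g z i := fun z i => by
    have := neg_one_le_pairPerturbation e w hwneg z i
    simp only [g]
    nlinarith
  have hU : uniform n ∈ stdSimplex ℝ (Fin n) := ⟨fun i => by simp [uniform], hu⟩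
  have hP : ∀ z, (fun i => uniform n i * (1 + g z i)) ∈ stdSimplex ℝ (Fin n) := fun z =>
    ⟨fun i => mul_nonneg (hU.1 i) (hg1 z i), by
      simp only [uniform, ← Finset.mul_sum, Finset.sum_add_distrib, hg]
      simp [hn'.ne']⟩
  have hacc : 2 / 3 ≤ outputProb (uniform n) A true :=
    (hA _ hU).1 ⟨0, by simp, (mixture_self _ _).symm⟩
  have hrej : ∀ z, 2 / 3 ≤ outputProb (fun i => uniform n i * (1 + g z i)) A false := by
    intro z
    refine (hA _ (hP z)).2 ?_
    rintro q ⟨α, -, rfl⟩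
    rw [mixture_self]
    have h1 : ∀ i, |uniform n i * (1 + g z i) - uniform n i| =
        ε / n * |pairPerturbation e w z i| := fun i => by
      rw [show uniform n i * (1 + g z i) - uniform n i = ε / n * pairPerturbation e w z i by
        simp only [uniform, g]; ring, abs_mul, abs_of_pos (div_pos hε hn')]
    simp only [l1Dist, h1, ← Finset.mul_sum]
    calc ε = ε / n * n := by field_simp
      _ ≤ _ := by
        gcongr
        exact le_sum_abs_pairPerturbation e w hwabs z
  have hchi := chiSq_lower_bound hn0 g hg A hacc hrej
  set t : ℝ := 2 * (k * ε ^ 2) / n with ht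
  have hterm : ∀ z z', (∑ i, uniform n i * ((1 + g z i) * (1 + g z' i))) ^ k ≤
      Real.exp (6 * (k * ε ^ 2) / n) *
        Real.exp (t * ∑ l, bitSign (z l) * bitSign (z' l)) := by
    intro z z'
    have hinner : ∑ i, uniform n i * ((1 + g z i) * (1 + g z' i)) =
        1 + ε ^ 2 / n * (∑ j, w j ^ 2 + 2 * ∑ l, bitSign (z l) * bitSign (z' l)) := by
      rw [← sum_pairPerturbation_mul e w z z']
      calc _ = ∑ i, (uniform n i + 1 / n * g z i + 1 / n * g z' i +
            ε ^ 2 / n * (pairPerturbation e w z i * pairPerturbation e w z' i)) := by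
            refine Finset.sum_congr rfl fun i _ => ?_
            simp only [uniform, g]
            ring
        _ = _ := by
            simp only [Finset.sum_add_distrib, ← Finset.mul_sum, hu, hg]
            ring
    have hnonneg : 0 ≤ ∑ i, uniform n i * ((1 + g z i) * (1 + g z' i)) :=
      Finset.sum_nonneg fun i _ => mul_nonneg (hU.1 i) (mul_nonneg (hg1 z i) (hg1 z' i))
    have hle : ∑ i, uniform n i * ((1 + g z i) * (1 + g z' i)) ≤
        Real.exp (ε ^ 2 / n * (6 + 2 * ∑ l, bitSign (z l) * bitSign (z' l))) := by
      refine le_trans ?_ (Real.add_one_le_exp _)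
      rw [hinner, add_comm]
      gcongr
    refine (pow_le_pow_left₀ hnonneg hle k).trans_eq ?_
    rw [← Real.exp_nat_mul, ← Real.exp_add, ht]
    congr 1
    ring
  have hsum : ∑ z, ∑ z', (∑ i, uniform n i * ((1 + g z i) * (1 + g z' i))) ^ k ≤
      Real.exp (6 * (k * ε ^ 2) / n) * (2 ^ N * (2 * Real.cosh t) ^ N) := by
    refine (Finset.sum_le_sum fun z _ => Finset.sum_le_sum fun z' _ => hterm z z').trans_eq ?_
    simp only [← Finset.mul_sum, sum_exp_bitSign]
    simp
  have hcard : (Fintype.card (Fin N → Bool) : ℝ) = 2 ^ N := by simp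
  rw [hcard] at hchi
  have hpow : (0 : ℝ) < (2 ^ N) ^ 2 := by positivity
  have h1 : 10 / 9 ≤ Real.exp (6 * (k * ε ^ 2) / n) * Real.cosh t ^ N := by
    refine le_of_mul_le_mul_right ((hchi.trans hsum).trans_eq ?_) hpow
    rw [mul_pow]
    ring
  refine h1.trans ?_
  rw [Real.exp_add]
  refine mul_le_mul_of_nonneg_left ?_ (Real.exp_pos _).le
  calc Real.cosh t ^ N ≤ Real.exp (t ^ 2 / 2) ^ N :=
        pow_le_pow_left₀ (Real.cosh_pos t).le (Real.cosh_le_exp_half_sq t) N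
    _ = Real.exp (N * (t ^ 2 / 2)) := (Real.exp_nat_mul _ _).symm
    _ ≤ _ := by
        apply Real.exp_le_exp.2
        have hN : (n : ℝ) = o + 2 * N := by exact_mod_cast card_eq_of_pair_equiv e
        have hN2 : (N : ℝ) ≤ n / 2 := by linarith [Nat.cast_nonneg (α := ℝ) o]
        calc (N : ℝ) * (t ^ 2 / 2) ≤ n / 2 * (t ^ 2 / 2) := by gcongr
          _ = _ := by rw [ht]; field_simp

/-- The lower bound. -/
lemma sample_lower_bound {n k : ℕ} {ε : ℝ} (hn : 2 ≤ n) (hε : 0 < ε) (hε1 : ε ≤ 1)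
    (A : SampleAlgorithm n k) (hA : IsMixtureTester (uniform n) (uniform n) ε A) :
    1 / 100 * (√n / ε ^ 2) ≤ k := by
  by_contra! hlt
  have hn1 : (1 : ℝ) ≤ n := by exact_mod_cast (by omega : 1 ≤ n)
  have hsqrt : 1 ≤ √(n : ℝ) := Real.one_le_sqrt.2 hn1
  have hsq : √(n : ℝ) ^ 2 = n := Real.sq_sqrt (by linarith)
  have hk : k * ε ^ 2 < √n / 100 := by
    rw [← mul_div_assoc, lt_div_iff₀ (by positivity)] at hlt
    linarith
  have hk0 : 0 ≤ k * ε ^ 2 := by positivity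
  have h := tester_chiSq_bound hn hε hε1 A hA
  have h1 : 6 * (k * ε ^ 2) / n ≤ 6 / 100 := by
    rw [div_le_iff₀ (by linarith)]
    nlinarith
  have h2 : (k * ε ^ 2) ^ 2 / n ≤ 1 / 10000 := by
    rw [div_le_iff₀ (by linarith)]
    nlinarith
  have h3 : Real.exp (6 * (k * ε ^ 2) / n + (k * ε ^ 2) ^ 2 / n) ≤ Real.exp (7 / 100) :=
    Real.exp_le_exp.2 (by linarith)
  -- Gives `exp(0.07) ≤ 1/0.93 < 10/9`, the contradiction.
  have h4 := Real.add_one_le_exp (-(7 / 100) : ℝ)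
  have h5 : Real.exp (7 / 100) * Real.exp (-(7 / 100)) = 1 := by
    rw [← Real.exp_add, add_neg_cancel, Real.exp_zero]
  nlinarith [Real.exp_pos (7 / 100 : ℝ)]

end MixtureTesting

theorem theorem1 :
    (∃ C₁ C₂ C : ℝ, 0 < C₁ ∧ 0 < C₂ ∧ 0 < C ∧
      ∀ (n : ℕ) (ε : ℝ), 0 < ε →
        ∀ q₁ ∈ stdSimplex ℝ (Fin n), ∀ q₂ ∈ stdSimplex ℝ (Fin n),
          ∃ m s : ℕ, m = ⌊C₁ / ε ^ 2⌋₊ ∧ s = ⌊C₂ * (√(n : ℝ) / ε ^ 2)⌋₊ ∧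
            ((m + s : ℕ) : ℝ) ≤ C * (√(n : ℝ) / ε ^ 2) ∧
            MixtureTesting.IsMixtureTester q₁ q₂ ε
              (MixtureTesting.mixtureIdentityTester q₁ q₂ ε m s)) ∧
    (∃ c : ℝ, 0 < c ∧
      ∀ (n : ℕ) (ε : ℝ), 2 ≤ n → 0 < ε → ε ≤ 1 →
        ∀ (k : ℕ) (A : MixtureTesting.SampleAlgorithm n k),
          MixtureTesting.IsMixtureTester
            (MixtureTesting.uniform n) (MixtureTesting.uniform n) ε A →
          c * (√(n : ℝ) / ε ^ 2) ≤ (k : ℝ)) := by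
  refine ⟨⟨10000, 10000, 20000, by norm_num, by norm_num, by norm_num, ?_⟩, 1 / 100, by norm_num,
    fun n ε hn hε hε1 k A hA => MixtureTesting.sample_lower_bound hn hε hε1 A hA⟩
  intro n ε hε q₁ h₁ q₂ h₂
  refine ⟨_, _, rfl, rfl, ?_, MixtureTesting.isMixtureTester_mixtureIdentityTester hε h₁ h₂
    (Nat.lt_floor_add_one _) (Nat.lt_floor_add_one _)⟩
  -- The simplex is empty for `n = 0`; `n ≥ 1` lets the testing budget dominate the learning budget.
  have hn : (1 : ℝ) ≤ n := by exact_mod_cast MixtureTesting.pos_of_mem_stdSimplex h₁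
  have hm := Nat.floor_le (show 0 ≤ 10000 / ε ^ 2 by positivity)
  have hs := Nat.floor_le (show 0 ≤ 10000 * (√(n : ℝ) / ε ^ 2) by positivity)
  have hle : 10000 / ε ^ 2 ≤ 10000 * (√(n : ℝ) / ε ^ 2) := by
    rw [← mul_div_assoc]
    gcongr
    linarith [Real.one_le_sqrt.2 hn]
  push_cast
  linarith
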